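/- **Setting.** Consider $N$ agents. The *score graph* is a digraph $G_S=(\{1,\dots,N\},E_S)$ in which every node has at least one incoming edge; each edge $(i,j)\in E_S$ carries a score $y_{ij}\in\{r_1,\dots,r_R\}$ given by $i$ to $j$. Let $n=|E_S|$, let $n_i$ be the in-degree of $i$, let $n_i^{(h)}=|\{j:(j,i)\in E_S,\ y_{ji}=r_h\}|$, and let $\phi^{(h)}=\sum_{i=1}^N n_i^{(h)}/n$ for $h=1,\dots,R$. Let $\Theta\subseteq\mathbb R^a$ and $P\subseteq\mathbb R^b$ be given sets, and let $p_{h|\ell,m}(\theta)$ and $p_\ell(\rho)$ ($1\le h\le R$, $1\le\ell,m\le C$) be given real functions. Put $$\mathcal S_\Theta=\Big\{\theta\in\Theta: p_{h|\ell,m}(\theta)\in[0,1],\ \sum_{h} p_{h|\ell,m}(\theta)=1\ \ \forall h,\ell,m\Big\},$$ $$\mathcal S_P=\Big\{\rho\in P: p_\ell(\rho)\in[0,1]\ \forall \ell,\ \sum_\ell p_\ell(\rho)=1\Big\},$$ let $S=\mathcal S_\Theta\times\mathcal S_P$ be the feasible set, and let $$g_{(h)}(\theta,\rho)=-\log\Big(\sum_{\ell,m=1}^C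 p_{h|\ell,m}(\theta)\,p_\ell(\rho)\,p_m(\rho)\Big),\qquad \phi^\top g=\sum_{h=1}^R\phi^{(h)}g_{(h)} .$$ **Algorithm.** At each time $t\in\mathbb Z_{\ge0}$ the agents communicate over a digraph $G_{\rm cmm}(t)$ on $\{1,\dots,N\}$. Let $N^I_i(t)$ be the set consisting of $i$ and its in-neighbors in $G_{\rm cmm}(t)$, and let $d_j(t)$ be the number of elements of the set consisting of $j$ and its out-neighbors. Starting from $\xi_i^{(h)}(0)=n_i^{(h)}$, $\eta_i(0)=n_i$, arbitrary $\phi_i(0)\in\mathbb R^R$ and arbitrary $z_i(0)\in S$, agent $i$ computes $$\xi_i^{(h)}(t+1)=\sum_{j\in N_i^I(t)}\frac{\xi_j^{(h)}(t)}{d_j(t)},\qquad \eta_i(t+1)=\sum_{j\in N_i^I(t)}\frac{\eta_j(t)}{d_j(t)},\qquad \phi_i^{(h)}(t+1)=\frac{\xi_i^{(h)}(t+1)}{\eta_i(t+1)},$$ $$z_i(t+1)=\Big[z_i(t)-\alpha\sum_{h=1}^R\phi_i^{(h)}(t)\,\nabla g_{(h)}(z_i(t))\Big]^+,$$ where $z_i(t)=(\hat\theta_i(t),\hat\rho_i(t))$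 and $[\cdot]^+$ is the Euclidean projection onto $S$. **Theorem.** Assume that 1. there is an integer $Q\ge1$ such that for every $t\ge0$ the graph $\bigcup_{\tau=tQ}^{(t+1)Q-1}G_{\rm cmm}(\tau)$ is strongly connected; 2. $S$ is compact and convex; 3. each $g_{(h)}$ is differentiable on $S$ (relative to $S$), and its gradients $\nabla g_{(h)}(z)$, $z\in S$, are bounded and Lipschitz continuous on $S$ with a constant $L>0$ that is common to all $h$; 4. $0<\alpha<2/L$. Then, for every agent $i$, every limit point $\hat z$ of the sequence $(z_i(t))_{t\ge0}$ is a stationary point of $\phi^\top g$ over $S$, that is, $\hat z\in S$ and $\langle\nabla(\phi^\top g)(\hat z),\,z-\hat z\rangle\ge0$ for all $z\in S$; equivalently, $\hat z$ is a fixed point of the projected gradient map: $$\hat z=\big[\hat z-\alpha\,\nabla(\phi^\top g)(\hat z)\big]^+ .$$ -/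

import Mathlib

open Filter Topology
open scoped NNReal

namespace InteractionLearning

noncomputable section

/-! ### Communication graph -/

/-- A digraph is strongly connected if every node is reachable from every node along a
(possibly empty) directed path. -/
def StronglyConnected {V : Type*} (G : Digraph V) : Prop :=
  ∀ i j : V, Relation.ReflTransGen G.Adj i j

/-- Joint strong connectivity with window length `Q`: for every `t ≥ 0` the union of the graphs
`G(τ)`, `τ = tQ, …, (t+1)Q - 1`, is strongly connected. -/
def JointlyStronglyConnected {V : Type*} (G : ℕ → Digraph V) (Q : ℕ) : Prop :=
  ∀ t : ℕ, StronglyConnected (⨆ τ ∈ Set.Ico (t * Q) ((t + 1) * Q), G τ)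

open Classical in
/-- In-neighborhood of node `i`, including `i` itself. -/
def inNbr {N : ℕ} (G : Digraph (Fin N)) (i : Fin N) : Finset (Fin N) :=
  Finset.univ.filter (fun j => G.Adj j i ∨ j = i)

open Classical in
/-- Out-neighborhood of node `i`, including `i` itself. -/
def outNbr {N : ℕ} (G : Digraph (Fin N)) (i : Fin N) : Finset (Fin N) :=
  Finset.univ.filter (fun j => G.Adj i j ∨ j = i)

/-! ### Score graph and probabilistic model -/

/-- The product of the parameter space `ℝᵃ` and the hyperparameter space `ℝᵇ`,
with its Euclidean inner product. -/
abbrev ParamSpace (a b : ℕ) : Type :=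
  WithLp 2 (EuclideanSpace ℝ (Fin a) × EuclideanSpace ℝ (Fin b))

/-- The data of an interaction-based learning problem with `N` agents, `R` score values
`r_1, …, r_R` and `C` state values `c_1, …, c_C`. -/
structure ScoreModel (N R C a b : ℕ) where
  /-- The score graph: `(i, j)` is an edge if agent `i` evaluates agent `j`. -/
  scoreGraph : Digraph (Fin N)
  /-- `score i j` is the index `h` of the score `r_h` given by `i` to `j`
  (relevant only if `(i, j)` is an edge of the score graph). -/
  score : Fin N → Fin N → Fin R
  /-- The given set of parameters `θ`. -/
  paramSet : Set (EuclideanSpace ℝ (Fin a))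
  /-- The given set of hyperparameters `ρ`. -/
  hyperSet : Set (EuclideanSpace ℝ (Fin b))
  /-- `pScore h ℓ m θ` is `p_{h|ℓ,m}(θ)`, the probability that the score is `r_h` when the
  evaluating agent has state `c_ℓ` and the evaluated one has state `c_m`. -/
  pScore : Fin R → Fin C → Fin C → EuclideanSpace ℝ (Fin a) → ℝ
  /-- `pState ℓ ρ` is `p_ℓ(ρ)`, the probability of the state `c_ℓ`. -/
  pState : Fin C → EuclideanSpace ℝ (Fin b) → ℝ

namespace ScoreModel

variable {N R C a b : ℕ} (M : ScoreModel N R C a b)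

/-- The parameters for which `p_{·|ℓ,m}` is a probability vector for all `ℓ, m`. -/
def feasibleParam : Set (EuclideanSpace ℝ (Fin a)) :=
  {θ | θ ∈ M.paramSet ∧ (∀ h ℓ m, M.pScore h ℓ m θ ∈ Set.Icc (0 : ℝ) 1) ∧
    ∀ ℓ m, ∑ h, M.pScore h ℓ m θ = 1}

/-- The hyperparameters for which `p_·` is a probability vector. -/
def feasibleHyper : Set (EuclideanSpace ℝ (Fin b)) :=
  {ρ | ρ ∈ M.hyperSet ∧ (∀ ℓ, M.pState ℓ ρ ∈ Set.Icc (0 : ℝ) 1) ∧ ∑ ℓ, M.pState ℓ ρ = 1}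

/-- The feasible set, the product of the two sets above. -/
def feasible : Set (ParamSpace a b) :=
  {z | z.fst ∈ M.feasibleParam ∧ z.snd ∈ M.feasibleHyper}

open Classical in
/-- The in-neighbors of agent `i` in the score graph, i.e. the agents that evaluate `i`. -/
def scorers (i : Fin N) : Finset (Fin N) :=
  Finset.univ.filter (fun j => M.scoreGraph.Adj j i)

/-- `n_i^{(h)}`: the number of scores `r_h` received by agent `i`. -/
def countScore (i : Fin N) (h : Fin R) : ℕ :=
  ((M.scorers i).filter (fun j => M.score j i = h)).card

/-- `n_i`: the number of incoming edges of agent `i` in the score graph. -/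
def inDeg (i : Fin N) : ℕ := (M.scorers i).card

open Classical in
/-- `n`: the total number of edges of the score graph. -/
def numEdges : ℕ :=
  (Finset.univ.filter (fun e : Fin N × Fin N => M.scoreGraph.Adj e.1 e.2)).card

/-- `φ^{(h)} = ∑ i, n_i^{(h)} / n`. -/
def phi (h : Fin R) : ℝ := ∑ i, (M.countScore i h : ℝ) / (M.numEdges : ℝ)

/-- `g_{(h)}(θ, ρ) = -log (∑_{ℓ,m} p_{h|ℓ,m}(θ) p_ℓ(ρ) p_m(ρ))`. -/
def g (h : Fin R) (z : ParamSpace a b) : ℝ :=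
  -Real.log (∑ ℓ, ∑ m, M.pScore h ℓ m z.fst * M.pState ℓ z.snd * M.pState m z.snd)

/-- The objective function `φᵀ g`. -/
def objective (z : ParamSpace a b) : ℝ := ∑ h, M.phi h * M.g h z

end ScoreModel

/-! ### Projection and stationarity -/

/-- Euclidean projection onto `S`: a point of `S` closest to `x`
(it exists if `S` is compact and nonempty, and is unique if `S` is convex). -/
def proj {E : Type*} [NormedAddCommGroup E] (S : Set E) (x : E) : E :=
  open Classical in
  if h : ∃ p ∈ S, ∀ y ∈ S, ‖x - p‖ ≤ ‖x - y‖ then h.choose else x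

/-- On a nonempty compact set, `proj S x` is a point of `S` closest to `x`. -/
theorem proj_spec {E : Type*} [NormedAddCommGroup E] {S : Set E} (hS : IsCompact S)
    (hne : S.Nonempty) (x : E) : proj S x ∈ S ∧ ∀ y ∈ S, ‖x - proj S x‖ ≤ ‖x - y‖ := by
  have h : ∃ p ∈ S, ∀ y ∈ S, ‖x - p‖ ≤ ‖x - y‖ := by
    obtain ⟨p, hp, hmin⟩ := hS.exists_isMinOn hne
      (f := fun y => ‖x - y‖) (by fun_prop)
    exact ⟨p, hp, fun y hy => hmin hy⟩
  unfold proj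
  rw [dif_pos h]
  exact h.choose_spec

/-- `z` is a stationary point of `f` over `S`: it lies in `S`, and `f` has at `z`
(relative to `S`) a gradient `v` with `⟨v, y - z⟩ ≥ 0` for all `y ∈ S`. -/
def IsStationaryPoint {E : Type*} [NormedAddCommGroup E] [InnerProductSpace ℝ E]
    [CompleteSpace E] (f : E → ℝ) (S : Set E) (z : E) : Prop :=
  z ∈ S ∧ ∃ v : E, HasGradientWithinAt f v S z ∧ ∀ y ∈ S, 0 ≤ inner ℝ v (y - z)

/-! ### The distributed algorithm -/

section Algorithm

variable {N R C a b : ℕ} (M : ScoreModel N R C a b) (G : ℕ → Digraph (Fin N))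

/-- The push-sum states `ξ_i^{(h)}(t)`. -/
def xi : ℕ → Fin N → Fin R → ℝ
  | 0, i, h => (M.countScore i h : ℝ)
  | t + 1, i, h => ∑ j ∈ inNbr (G t) i, xi t j h / ((outNbr (G t) j).card : ℝ)

/-- The push-sum states `η_i(t)`. -/
def eta : ℕ → Fin N → ℝ
  | 0, i => (M.inDeg i : ℝ)
  | t + 1, i => ∑ j ∈ inNbr (G t) i, eta t j / ((outNbr (G t) j).card : ℝ)

/-- The estimates `φ_i^{(h)}(t)`, with initial values `phi0`. -/
def phiEst (phi0 : Fin N → Fin R → ℝ) : ℕ → Fin N → Fin R → ℝ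
  | 0, i, h => phi0 i h
  | t + 1, i, h => xi M G (t + 1) i h / eta M G (t + 1) i

/-- The estimates `(θ_i(t), ρ_i(t))`, with initial values `z0`, stepsize `α` and gradients
`gradG h` of the functions `g_{(h)}`. -/
def iterate (phi0 : Fin N → Fin R → ℝ) (z0 : Fin N → ParamSpace a b) (α : ℝ)
    (gradG : Fin R → ParamSpace a b → ParamSpace a b) : ℕ → Fin N → ParamSpace a b
  | 0, i => z0 i
  | t + 1, i =>
      proj M.feasible (iterate phi0 z0 α gradG t i -
        α • ∑ h, phiEst M G phi0 t i h • gradG h (iterate phi0 z0 α gradG t i))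

end Algorithm

end

end InteractionLearning

/-!
The proof separates the consensus part of the algorithm from its optimization part.

*Consensus.* Push-sum steps are linear, preserve the total and preserve nonnegativity. A
nonnegative push-sum state loses at most a factor `1 / N` along each edge and each self-loop, so
whatever one node holds at the beginning of a window has, up to a fixed factor, reached every node
after `N` windows (`pow_mul_le_of_jointlyStronglyConnected`). Applied to `η`, this keeps `η` away
from zero. If all ratios `ξ / η` lie in `[a, b]`, it applies also to the push-sum states `ξ - a η`
and `b η - ξ`, one of which is large at any given node; hence the interval containing the ratios
shrinks by a fixed factor every `N` windows (`IsPushSum.exists_contraction`). The ratio of the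
totals stays in this interval, so the estimates of the frequencies `φ` converge geometrically, and
in particular with *summable* errors (`IsPushSum.summable_abs_div_sub`).

*Optimization.* Since `φ` is a probability vector, `φᵀ g` has an `L`-Lipschitz gradient, and each
agent runs a projected gradient method for `φᵀ g` with summable gradient errors. The descent lemma
and the obtuse angle criterion for the projection show that each step decreases the objective by
`1 / α - L / 2 > 0` times its squared length, up to a summable error; as the objective is bounded
below, the steps tend to zero (`tendsto_step_zero_of_summable_error`). The obtuse angle
criterion then passes to the limit along a convergent subsequence, which gives the variational
inequality at the limit point, and this inequality characterizes the fixed points of the projected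
gradient map. Summability is essential here: convergence of the estimates alone would not make the
accumulated errors finite.
-/

namespace InteractionLearning

/-! ### Projected gradient descent with summable errors -/

section ProjectedGradient

variable {E : Type*} [NormedAddCommGroup E] [InnerProductSpace ℝ E]

/-- The obtuse angle criterion for the projection onto a convex set. -/
theorem inner_sub_proj_le_zero {S : Set E} (hS : IsCompact S) (hne : S.Nonempty)
    (hconv : Convex ℝ S) (x : E) {y : E} (hy : y ∈ S) :
    inner ℝ (x - proj S x) (y - proj S x) ≤ 0 := by
  obtain ⟨hmem, hmin⟩ := proj_spec hS hne x
  refine (norm_eq_iInf_iff_real_inner_le_zero hconv hmem).1 ?_ y hy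
  have : Nonempty S := ⟨⟨_, hmem⟩⟩
  refine le_antisymm (le_ciInf fun w => hmin w w.2) ?_
  exact ciInf_le (f := fun w : S => ‖x - w‖)
    ⟨0, by rintro _ ⟨w, rfl⟩; exact norm_nonneg _⟩ ⟨_, hmem⟩

/-- A point of `S` satisfying the obtuse angle criterion is the projection. -/
theorem eq_proj_of_inner_le_zero {S : Set E} (hS : IsCompact S) (hconv : Convex ℝ S)
    {x p : E} (hp : p ∈ S) (h : ∀ y ∈ S, inner ℝ (x - p) (y - p) ≤ 0) : p = proj S x := by
  have h1 := h _ (proj_spec hS ⟨p, hp⟩ x).1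
  have h2 := inner_sub_proj_le_zero hS ⟨p, hp⟩ hconv x hp
  set q := proj S x
  -- adding the two criteria, each tested at the other point, gives `‖q - p‖² ≤ 0`
  have h3 : inner ℝ (q - p) (q - p) = inner ℝ (x - p) (q - p) + inner ℝ (x - q) (p - q) := by
    rw [← neg_sub q p, inner_neg_right, ← sub_eq_add_neg, ← inner_sub_left]
    congr 1
    abel
  have h4 : inner ℝ (q - p) (q - p) ≤ 0 := by linarith
  exact (sub_eq_zero.1 (real_inner_self_nonpos.1 h4)).symm

variable [CompleteSpace E]

/-- The descent lemma on a convex set, for gradients relative to the set. -/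
theorem le_add_inner_add_of_lipschitzOnWith_gradient {S : Set E} (hconv : Convex ℝ S)
    {f : E → ℝ} {F : E → E} {L : ℝ≥0} (hf : ∀ z ∈ S, HasGradientWithinAt f (F z) S z)
    (hF : LipschitzOnWith L F S) {x y : E} (hx : x ∈ S) (hy : y ∈ S) :
    f y ≤ f x + inner ℝ (F x) (y - x) + L / 2 * ‖y - x‖ ^ 2 := by
  have hmem : ∀ t ∈ Set.Icc (0 : ℝ) 1, x + t • (y - x) ∈ S := fun t ht =>
    hconv.add_smul_sub_mem hx hy ht
  have hline : ∀ t : ℝ, HasDerivAt (fun t : ℝ => x + t • (y - x)) (y - x) t := fun t => by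
    simpa using ((hasDerivAt_id t).smul_const (y - x)).const_add x
  have hderiv : ∀ t ∈ Set.Icc (0 : ℝ) 1,
      HasDerivWithinAt (fun t : ℝ => f (x + t • (y - x)) - t * inner ℝ (F x) (y - x)
          - L / 2 * t ^ 2 * ‖y - x‖ ^ 2)
        (inner ℝ (F (x + t • (y - x))) (y - x) - inner ℝ (F x) (y - x)
          - L * t * ‖y - x‖ ^ 2) (Set.Icc 0 1) t := by
    intro t ht
    have h1 := (hf _ (hmem t ht)).hasFDerivWithinAt.comp_hasDerivWithinAt t
      (hline t).hasDerivWithinAt (s := Set.Icc 0 1) hmem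
    have h2 := ((hasDerivAt_id t).mul_const (inner ℝ (F x) (y - x))).hasDerivWithinAt
      (s := Set.Icc 0 1)
    have h3 := ((((hasDerivAt_id t).pow 2).const_mul ((L : ℝ) / 2)).mul_const
      (‖y - x‖ ^ 2)).hasDerivWithinAt (s := Set.Icc 0 1)
    refine ((h1.sub h2).sub h3).congr_deriv ?_
    rw [InnerProductSpace.toDual_apply_apply]
    simp only [id, Nat.cast_ofNat]
    ring
  have hanti := antitoneOn_of_hasDerivWithinAt_nonpos (convex_Icc (0 : ℝ) 1)
    (fun t ht => (hderiv t ht).continuousWithinAt)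
    (fun t ht => (hderiv t (interior_subset ht)).mono interior_subset) (fun t ht => by
      have ht' := interior_subset ht
      have h1 : ‖F (x + t • (y - x)) - F x‖ ≤ L * (t * ‖y - x‖) := by
        have := hF.norm_sub_le (hmem t ht') hx
        rwa [add_sub_cancel_left, norm_smul, Real.norm_of_nonneg ht'.1] at this
      have h2 : inner ℝ (F (x + t • (y - x)) - F x) (y - x)
          ≤ L * (t * ‖y - x‖) * ‖y - x‖ :=
        (real_inner_le_norm _ _).trans (by gcongr)
      rw [inner_sub_left] at h2
      linarith)
  have h := hanti (Set.left_mem_Icc.2 zero_le_one) (Set.right_mem_Icc.2 zero_le_one) zero_le_one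
  simp only [one_smul, add_sub_cancel, one_mul, one_pow, mul_one, zero_smul, add_zero, zero_mul,
    sub_zero, ne_eq, OfNat.ofNat_ne_zero, not_false_eq_true, zero_pow, mul_zero] at h
  linarith

/-- The steps of an inexact projected gradient method with summable gradient errors vanish:
each step decreases `f` by a multiple of its squared length, up to a summable error, and `f` is
bounded below. -/
theorem tendsto_step_zero_of_summable_error {S : Set E} (hS : IsCompact S) (hconv : Convex ℝ S)
    {f : E → ℝ} {F : E → E} {L : ℝ≥0} (hL : 0 < L)
    (hf : ∀ z ∈ S, HasGradientWithinAt f (F z) S z) (hF : LipschitzOnWith L F S)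
    {α : ℝ} (hα : 0 < α) (hαL : α < 2 / (L : ℝ)) {z e : ℕ → E} (hz : ∀ t, z t ∈ S)
    (hstep : ∀ t, z (t + 1) = proj S (z t - α • (F (z t) + e t)))
    (he : Summable fun t => ‖e t‖) :
    Tendsto (fun t => z (t + 1) - z t) atTop (𝓝 0) := by
  have hL' : (0 : ℝ) < L := hL
  set c : ℝ := 1 / α - L / 2 with hc
  have hcpos : 0 < c := by
    rw [lt_div_iff₀ hL'] at hαL
    rw [hc, sub_pos, div_lt_div_iff₀ two_pos hα]
    linarith
  obtain ⟨D, hD⟩ := Metric.isBounded_iff.1 hS.isBounded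
  obtain ⟨m, -, hm⟩ := hS.exists_isMinOn ⟨z 0, hz 0⟩
    (fun x hx => (hf x hx).continuousWithinAt)
  have hdesc : ∀ t, c * ‖z (t + 1) - z t‖ ^ 2 ≤ f (z t) - f (z (t + 1)) + D * ‖e t‖ := by
    intro t
    have h1 := le_add_inner_add_of_lipschitzOnWith_gradient hconv hf hF (hz t) (hz (t + 1))
    have h2 := inner_sub_proj_le_zero hS ⟨z 0, hz 0⟩ hconv (z t - α • (F (z t) + e t)) (hz t)
    rw [← hstep] at h2
    have h3 : inner ℝ (z t - α • (F (z t) + e t) - z (t + 1)) (z t - z (t + 1))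
        = ‖z (t + 1) - z t‖ ^ 2 + α * (inner ℝ (F (z t)) (z (t + 1) - z t)
          + inner ℝ (e t) (z (t + 1) - z t)) := by
      have h5 : z t - α • (F (z t) + e t) - z (t + 1)
          = -((z (t + 1) - z t) + α • (F (z t) + e t)) := by abel
      rw [h5, ← neg_sub (z (t + 1)) (z t), inner_neg_neg, inner_add_left, real_inner_smul_left,
        inner_add_left, real_inner_self_eq_norm_sq]
    have h4 : -inner ℝ (e t) (z (t + 1) - z t) ≤ D * ‖e t‖ := by
      have := abs_real_inner_le_norm (e t) (z (t + 1) - z t)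
      have h5 : ‖z (t + 1) - z t‖ ≤ D := by
        rw [← dist_eq_norm]; exact hD (hz _) (hz _)
      nlinarith [neg_abs_le (inner ℝ (e t) (z (t + 1) - z t)), norm_nonneg (e t)]
    have h6 : 1 / α * ‖z (t + 1) - z t‖ ^ 2 ≤ -(inner ℝ (F (z t)) (z (t + 1) - z t)
          + inner ℝ (e t) (z (t + 1) - z t)) := by
      rw [div_mul_eq_mul_div, div_le_iff₀ hα]
      linarith
    rw [hc]
    linarith
  have hsum : Summable fun t => c * ‖z (t + 1) - z t‖ ^ 2 := by
    refine summable_of_sum_range_le (c := f (z 0) - f m + ∑' t, D * ‖e t‖)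
      (fun t => by positivity) fun n => (Finset.sum_le_sum fun t _ => hdesc t).trans ?_
    rw [Finset.sum_add_distrib, Finset.sum_range_sub']
    have hD0 : 0 ≤ D := dist_nonneg.trans (hD (hz 0) (hz 0))
    exact add_le_add (sub_le_sub_left (hm (hz n)) _)
      ((he.mul_left D).sum_le_tsum _ fun t _ => by positivity)
  have hsq : Tendsto (fun t => ‖z (t + 1) - z t‖ ^ 2) atTop (𝓝 0) :=
    (summable_mul_left_iff hcpos.ne').1 hsum |>.tendsto_atTop_zero
  rw [tendsto_zero_iff_norm_tendsto_zero]
  simpa using hsq.sqrt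

/-- Limit points of an inexact projected gradient method with summable gradient errors satisfy
the first-order variational inequality. -/
theorem inner_gradient_nonneg_of_mapClusterPt {S : Set E} (hS : IsCompact S)
    (hconv : Convex ℝ S) {f : E → ℝ} {F : E → E} {L : ℝ≥0} (hL : 0 < L)
    (hf : ∀ z ∈ S, HasGradientWithinAt f (F z) S z) (hF : LipschitzOnWith L F S)
    {α : ℝ} (hα : 0 < α) (hαL : α < 2 / (L : ℝ)) {z e : ℕ → E} (hz : ∀ t, z t ∈ S)
    (hstep : ∀ t, z (t + 1) = proj S (z t - α • (F (z t) + e t)))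
    (he : Summable fun t => ‖e t‖) {w : E} (hw : MapClusterPt w atTop z) :
    w ∈ S ∧ ∀ y ∈ S, 0 ≤ inner ℝ (F w) (y - w) := by
  have hwS : w ∈ S := hS.isClosed.mem_of_mapClusterPt hw (Eventually.of_forall hz)
  refine ⟨hwS, fun y hy => ?_⟩
  obtain ⟨ψ, hψ, hlim⟩ := hw.tendsto_subseq
  have hstep0 := (tendsto_step_zero_of_summable_error hS hconv hL hf hF hα hαL hz hstep
    he).comp hψ.tendsto_atTop
  have hnext : Tendsto (fun k => z (ψ k + 1)) atTop (𝓝 w) := by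
    simpa using hstep0.add hlim
  have he0 : Tendsto (fun k => e (ψ k)) atTop (𝓝 0) :=
    (tendsto_zero_iff_norm_tendsto_zero.2 he.tendsto_atTop_zero).comp hψ.tendsto_atTop
  have hFlim : Tendsto (fun k => F (z (ψ k))) atTop (𝓝 (F w)) :=
    (hF.continuousOn w hwS).tendsto.comp
      (tendsto_nhdsWithin_iff.2 ⟨hlim, Eventually.of_forall fun k => hz _⟩)
  have hlim' : Tendsto (fun k => inner ℝ
      (z (ψ k) - α • (F (z (ψ k)) + e (ψ k)) - z (ψ k + 1)) (y - z (ψ k + 1))) atTop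
      (𝓝 (inner ℝ (w - α • (F w + 0) - w) (y - w))) :=
    ((Tendsto.sub hlim ((hFlim.add he0).const_smul α)).sub hnext).inner
      (tendsto_const_nhds.sub hnext)
  have hle := le_of_tendsto' hlim' fun k => by
    rw [hstep (ψ k)]
    exact inner_sub_proj_le_zero hS ⟨w, hwS⟩ hconv _ hy
  rw [add_zero, sub_sub_cancel_left, inner_neg_left, real_inner_smul_left, neg_nonpos] at hle
  exact nonneg_of_mul_nonneg_right hle hα

end ProjectedGradient

/-! ### Push-sum averaging over jointly strongly connected graphs -/

section PushSum

variable {N : ℕ} {G : ℕ → Digraph (Fin N)} {Q : ℕ}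

theorem mem_inNbr {G : Digraph (Fin N)} {i j : Fin N} :
    j ∈ inNbr G i ↔ G.Adj j i ∨ j = i := by
  simp [inNbr]

theorem mem_outNbr {G : Digraph (Fin N)} {i j : Fin N} :
    j ∈ outNbr G i ↔ G.Adj i j ∨ j = i := by
  simp [outNbr]

theorem card_outNbr_pos (G : Digraph (Fin N)) (j : Fin N) : 0 < (outNbr G j).card :=
  Finset.card_pos.2 ⟨j, mem_outNbr.2 (Or.inr rfl)⟩

theorem card_outNbr_le (G : Digraph (Fin N)) (j : Fin N) : (outNbr G j).card ≤ N := by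
  simpa using Finset.card_le_univ (outNbr G j)

/-- In a strongly connected digraph some edge leaves every nonempty proper set of nodes. -/
theorem StronglyConnected.exists_adj_mem_notMem {V : Type*} {G : Digraph V}
    (hG : StronglyConnected G) {A : Set V} {k l : V} (hk : k ∈ A) (hl : l ∉ A) :
    ∃ j ∈ A, ∃ i ∉ A, G.Adj j i := by
  by_contra! h
  have hreach : ∀ i, Relation.ReflTransGen G.Adj k i → i ∈ A := fun i hi => by
    induction hi with
    | refl => exact hk
    | tail _ hadj ih => exact by_contra fun hc => h _ ih _ hc hadj
  exact hl (hreach l (hG k l))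

/-- A quantity that loses at most a factor `β` along each edge and each self-loop loses at most
`β ^ r` at a fixed node within `r` steps. -/
theorem pow_mul_le_of_selfLoop {β : ℝ} (hβ : 0 ≤ β) {x : ℕ → Fin N → ℝ} {s : ℕ}
    (hx : ∀ t ≥ s, ∀ i, ∀ j ∈ inNbr (G t) i, β * x t j ≤ x (t + 1) i) (i : Fin N) {t : ℕ}
    (ht : s ≤ t) (r : ℕ) : β ^ r * x t i ≤ x (t + r) i := by
  induction r with
  | zero => simp
  | succ r ih =>
    refine le_trans ?_ (hx (t + r) (by omega) i i (mem_inNbr.2 (Or.inr rfl)))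
    rw [pow_succ', mul_assoc]
    gcongr

theorem pow_mul_le_of_adj_iSup {β : ℝ} (hβ : 0 ≤ β) {x : ℕ → Fin N → ℝ} {s : ℕ}
    (hx : ∀ t ≥ s, ∀ i, ∀ j ∈ inNbr (G t) i, β * x t j ≤ x (t + 1) i) {i j : Fin N}
    (hadj : (⨆ τ ∈ Set.Ico s (s + Q), G τ).Adj j i) : β ^ Q * x s j ≤ x (s + Q) i := by
  simp only [Digraph.iSup_adj, Set.mem_Ico] at hadj
  obtain ⟨τ, ⟨hsτ, hτ⟩, hadj⟩ := hadj
  obtain ⟨p, rfl⟩ := Nat.exists_eq_add_of_le hsτ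
  obtain ⟨r, rfl⟩ : ∃ r, Q = p + 1 + r := Nat.exists_eq_add_of_le (by omega)
  have h1 := pow_mul_le_of_selfLoop hβ hx j le_rfl p
  have h2 := hx (s + p) hsτ i j (mem_inNbr.2 (Or.inl hadj))
  have h3 := pow_mul_le_of_selfLoop hβ hx i (t := s + p + 1) (by omega) r
  calc β ^ (p + 1 + r) * x s j = β ^ r * (β * (β ^ p * x s j)) := by ring
    _ ≤ β ^ r * x (s + p + 1) i := by
      refine mul_le_mul_of_nonneg_left (le_trans ?_ h2) (pow_nonneg hβ r)
      gcongr
    _ ≤ x (s + (p + 1 + r)) i := by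
      rw [← add_assoc, ← add_assoc]
      exact h3

/-- The mass `c` found at one node at the beginning of a window has reached every node, up to the
factor `β ^ (N * Q)`, after `N` windows: in each window the set of nodes reached grows until it
is everything. -/
theorem pow_mul_le_of_jointlyStronglyConnected (hG : JointlyStronglyConnected G Q) {β : ℝ}
    (hβ : 0 ≤ β) {x : ℕ → Fin N → ℝ} {m : ℕ}
    (hx : ∀ t ≥ m * Q, ∀ i, ∀ j ∈ inNbr (G t) i, β * x t j ≤ x (t + 1) i) {c : ℝ} {k : Fin N}
    (hk : c ≤ x (m * Q) k) (i : Fin N) : β ^ (N * Q) * c ≤ x ((m + N) * Q) i := by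
  classical
  set A : ℕ → Finset (Fin N) := fun n =>
    Finset.univ.filter fun i => β ^ (n * Q) * c ≤ x ((m + n) * Q) i with hA
  have hmono : ∀ n, A n ⊆ A (n + 1) := by
    intro n l hl
    simp only [hA, Finset.mem_filter, Finset.mem_univ, true_and] at hl ⊢
    have h := pow_mul_le_of_selfLoop hβ hx l (t := (m + n) * Q)
      (Nat.mul_le_mul_right _ (Nat.le_add_right m n)) Q
    rw [show (m + (n + 1)) * Q = (m + n) * Q + Q by ring]
    refine le_trans ?_ h
    rw [show (n + 1) * Q = Q + n * Q by ring, pow_add, mul_assoc]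
    gcongr
  have hcard : ∀ n, min (n + 1) N ≤ (A n).card := by
    intro n
    induction n with
    | zero =>
      refine (min_le_left _ _).trans (Finset.card_pos.2 ⟨k, ?_⟩)
      simpa [hA] using hk
    | succ n ih =>
      by_cases hfull : N ≤ (A n).card
      · exact (min_le_right _ _).trans (hfull.trans (Finset.card_le_card (hmono n)))
      have hne : (A n).Nonempty := by
        rw [← Finset.card_pos]
        have := k.pos
        omega
      obtain ⟨k', hk'⟩ := hne
      obtain ⟨l, hl⟩ : ∃ l, l ∉ A n := by
        by_contra! h
        rw [Finset.eq_univ_iff_forall.2 h, Finset.card_univ, Fintype.card_fin] at hfull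
        exact hfull le_rfl
      obtain ⟨j, hj, i', hi', hadj⟩ :=
        (hG (m + n)).exists_adj_mem_notMem (A := (A n : Set (Fin N))) hk' hl
      have hmem : i' ∈ A (n + 1) := by
        simp only [hA, Finset.coe_filter, Finset.mem_filter, Finset.mem_univ, true_and,
          Set.mem_ofPred_eq] at hj ⊢
        rw [show (m + n + 1) * Q = (m + n) * Q + Q by ring] at hadj
        have h := pow_mul_le_of_adj_iSup hβ
          (fun t ht => hx t (le_trans (Nat.mul_le_mul_right _ (Nat.le_add_right m n)) ht)) hadj
        rw [show (m + (n + 1)) * Q = (m + n) * Q + Q by ring]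
        refine le_trans ?_ h
        rw [show (n + 1) * Q = Q + n * Q by ring, pow_add, mul_assoc]
        gcongr
      have hlt : (A n).card < (A (n + 1)).card :=
        Finset.card_lt_card ⟨hmono n, fun h => hi' (h hmem)⟩
      omega
  have huniv : A N = Finset.univ := by
    refine Finset.eq_univ_of_card _ (le_antisymm (Finset.card_le_univ _) ?_)
    have := hcard N
    rw [Fintype.card_fin]
    omega
  have hi : i ∈ A N := huniv ▸ Finset.mem_univ i
  simpa [hA] using hi

/-- `u` evolves by the push-sum recursion over the graphs `G t`: every node splits its value
equally among itself and its out-neighbors. -/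
def IsPushSum (G : ℕ → Digraph (Fin N)) (u : ℕ → Fin N → ℝ) : Prop :=
  ∀ t i, u (t + 1) i = ∑ j ∈ inNbr (G t) i, u t j / ((outNbr (G t) j).card : ℝ)

namespace IsPushSum

variable {u v : ℕ → Fin N → ℝ}

theorem sub (hu : IsPushSum G u) (hv : IsPushSum G v) :
    IsPushSum G fun t i => u t i - v t i := fun t i => by
  simp only [hu t i, hv t i, sub_div, Finset.sum_sub_distrib]

theorem const_mul (hu : IsPushSum G u) (c : ℝ) : IsPushSum G fun t i => c * u t i := fun t i => by
  simp only [hu t i, Finset.mul_sum, mul_div_assoc]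

theorem sum_eq (hu : IsPushSum G u) (t : ℕ) : ∑ i, u t i = ∑ i, u 0 i := by
  induction t with
  | zero => rfl
  | succ t ih =>
    rw [← ih]
    simp only [hu t]
    rw [Finset.sum_comm' (t' := Finset.univ) (s' := fun j => outNbr (G t) j)
      (by intro i j; simp [mem_inNbr, mem_outNbr, eq_comm])]
    refine Finset.sum_congr rfl fun j _ => ?_
    rw [Finset.sum_const, nsmul_eq_mul, mul_div_cancel₀]
    exact_mod_cast (card_outNbr_pos (G t) j).ne'

theorem nonneg (hu : IsPushSum G u) {s t : ℕ} (hs : ∀ i, 0 ≤ u s i) (hst : s ≤ t) (i : Fin N) :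
    0 ≤ u t i := by
  induction t, hst using Nat.le_induction generalizing i with
  | base => exact hs i
  | succ t _ ih =>
    rw [hu t i]
    exact Finset.sum_nonneg fun j _ => div_nonneg (ih j) (Nat.cast_nonneg _)

/-- A node hands at least the fraction `1 / N` of a nonnegative value to each out-neighbor. -/
theorem inv_mul_le (hu : IsPushSum G u) {t : ℕ} (ht : ∀ i, 0 ≤ u t i) {i j : Fin N}
    (hj : j ∈ inNbr (G t) i) : (N : ℝ)⁻¹ * u t j ≤ u (t + 1) i := by
  rw [hu t i]
  refine le_trans ?_ (Finset.single_le_sum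
    (fun k _ => div_nonneg (ht k) (Nat.cast_nonneg (outNbr (G t) k).card)) hj)
  rw [div_eq_inv_mul]
  refine mul_le_mul_of_nonneg_right ?_ (ht j)
  exact inv_anti₀ (by exact_mod_cast card_outNbr_pos (G t) j)
    (by exact_mod_cast card_outNbr_le (G t) j)

/-- A nonnegative push-sum state at one node at the beginning of a window bounds from below the
states of all nodes `N` windows later. -/
theorem pow_mul_le (hu : IsPushSum G u) (hG : JointlyStronglyConnected G Q) {m : ℕ}
    (hm : ∀ i, 0 ≤ u (m * Q) i) {c : ℝ} {k : Fin N} (hk : c ≤ u (m * Q) k) (i : Fin N) :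
    ((N : ℝ)⁻¹) ^ (N * Q) * c ≤ u ((m + N) * Q) i :=
  pow_mul_le_of_jointlyStronglyConnected hG (by positivity)
    (fun _ ht _ _ hj => hu.inv_mul_le (hu.nonneg hm ht) hj) hk i

/-- The states of a push-sum recursion started at positive values stay bounded away from zero. -/
theorem exists_pos_le (hu : IsPushSum G u) (hG : JointlyStronglyConnected G Q) (hQ : 1 ≤ Q)
    {c : ℝ} (hc : 0 < c) (h0 : ∀ i, c ≤ u 0 i) : ∃ δ > 0, ∀ t i, δ ≤ u t i := by
  rcases Nat.eq_zero_or_pos N with rfl | hN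
  · exact ⟨1, one_pos, fun _ i => i.elim0⟩
  have hN' : (0 : ℝ) < N := by exact_mod_cast hN
  have hT : 0 < N * Q := Nat.mul_pos hN hQ
  have hβ1 : (N : ℝ)⁻¹ ≤ 1 := inv_le_one_of_one_le₀ (by exact_mod_cast hN)
  have hnn : ∀ t i, 0 ≤ u t i := fun t => hu.nonneg (fun i => hc.le.trans (h0 i)) (Nat.zero_le t)
  set β : ℝ := (N : ℝ)⁻¹
  have hβ0 : 0 < β := inv_pos.2 hN'
  have hblock : ∀ k i, β ^ (N * Q) * c ≤ u (k * N * Q) i := by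
    intro k i
    cases k with
    | zero =>
      simp only [zero_mul]
      exact (mul_le_of_le_one_left hc.le (pow_le_one₀ hβ0.le hβ1)).trans (h0 i)
    | succ k =>
      -- the average state is preserved, so some state is at least `c`
      obtain ⟨j, -, hj⟩ : ∃ j ∈ Finset.univ, c ≤ u (k * N * Q) j := by
        refine Finset.exists_le_of_sum_le ⟨i, Finset.mem_univ i⟩ ?_
        rw [hu.sum_eq]
        exact Finset.sum_le_sum fun j _ => h0 j
      have := hu.pow_mul_le hG (m := k * N) (hnn _) hj i
      rwa [← Nat.succ_mul] at this
  refine ⟨β ^ (N * Q) * (β ^ (N * Q) * c), by positivity, fun t i => ?_⟩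
  have h1 := pow_mul_le_of_selfLoop (x := u) (s := 0) hβ0.le
    (fun t _ _ _ hj => hu.inv_mul_le (hnn t) hj) i (Nat.zero_le (t / (N * Q) * N * Q))
    (t % (N * Q))
  rw [mul_assoc (t / (N * Q)), Nat.div_add_mod'] at h1
  refine le_trans ?_ h1
  have h2 := hblock (t / (N * Q)) i
  rw [mul_assoc (t / (N * Q))] at h2
  exact mul_le_mul (pow_le_pow_of_le_one hβ0.le hβ1 (Nat.mod_lt _ hT).le) h2 (by positivity)
    (by positivity)

/-- If the ratios `u i / v i` lie in `[a, b]` at the beginning of a window, then `N` windows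
later they lie in a subinterval that is shorter by a fixed factor. -/
theorem exists_contraction (hu : IsPushSum G u) (hv : IsPushSum G v)
    (hG : JointlyStronglyConnected G Q) {δ D : ℝ} (hδ : 0 < δ) (hvδ : ∀ t i, δ ≤ v t i)
    (hvD : ∀ t i, v t i ≤ D) (k₀ : Fin N) {m : ℕ} {a b : ℝ}
    (ha : ∀ i, a * v (m * Q) i ≤ u (m * Q) i) (hb : ∀ i, u (m * Q) i ≤ b * v (m * Q) i) :
    ∃ a' b', b' - a' = (1 - ((N : ℝ)⁻¹) ^ (N * Q) * (δ / (2 * D))) * (b - a) ∧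
      (∀ i, a' * v ((m + N) * Q) i ≤ u ((m + N) * Q) i) ∧
      ∀ i, u ((m + N) * Q) i ≤ b' * v ((m + N) * Q) i := by
  have hle : m * Q ≤ (m + N) * Q := Nat.mul_le_mul_right _ (Nat.le_add_right m N)
  have hD : 0 < D := (hδ.trans_le (hvδ 0 k₀)).trans_le (hvD 0 k₀)
  have hab : 0 ≤ b - a := by
    have := (ha k₀).trans (hb k₀)
    exact sub_nonneg.2 (le_of_mul_le_mul_right this (hδ.trans_le (hvδ _ k₀)))
  set p : ℝ := ((N : ℝ)⁻¹) ^ (N * Q)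
  have hp0 : 0 ≤ p := by positivity
  have hla := hu.sub (hv.const_mul a)
  have hlb := (hv.const_mul b).sub hu
  have ha0 : ∀ i, 0 ≤ u (m * Q) i - a * v (m * Q) i := fun i => sub_nonneg.2 (ha i)
  have hb0 : ∀ i, 0 ≤ b * v (m * Q) i - u (m * Q) i := fun i => sub_nonneg.2 (hb i)
  have hγ : ∀ i, p * (δ / (2 * D)) * (b - a) * v ((m + N) * Q) i ≤ p * (δ * ((b - a) / 2)) := by
    intro i
    have h1 : δ / (2 * D) * v ((m + N) * Q) i ≤ δ / 2 := by
      rw [div_mul_eq_mul_div, div_le_div_iff₀ (by positivity) two_pos]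
      nlinarith [hvD ((m + N) * Q) i]
    calc p * (δ / (2 * D)) * (b - a) * v ((m + N) * Q) i
        = p * (b - a) * (δ / (2 * D) * v ((m + N) * Q) i) := by ring
      _ ≤ p * (b - a) * (δ / 2) := by gcongr
      _ = _ := by ring
  -- the ratio of node `k₀` is in the upper or in the lower half of `[a, b]`; accordingly
  -- `u - a v` or `b v - u` spreads from `k₀` to all nodes
  rcases le_total ((a + b) / 2 * v (m * Q) k₀) (u (m * Q) k₀) with h | h
  · refine ⟨a + p * (δ / (2 * D)) * (b - a), b, by ring, fun i => ?_, fun i => ?_⟩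
    · have h1 : δ * ((b - a) / 2) ≤ u (m * Q) k₀ - a * v (m * Q) k₀ := by
        nlinarith [hvδ (m * Q) k₀]
      have h2 := hla.pow_mul_le hG ha0 h1 i
      nlinarith [hγ i]
    · exact sub_nonneg.1 (hlb.nonneg hb0 hle i)
  · refine ⟨a, b - p * (δ / (2 * D)) * (b - a), by ring, fun i => ?_, fun i => ?_⟩
    · exact sub_nonneg.1 (hla.nonneg ha0 hle i)
    · have h1 : δ * ((b - a) / 2) ≤ b * v (m * Q) k₀ - u (m * Q) k₀ := by
        nlinarith [hvδ (m * Q) k₀]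
      have h2 := hlb.pow_mul_le hG hb0 h1 i
      nlinarith [hγ i]

/-- Push-sum ratio consensus: the ratios converge to the ratio of the initial totals, with
summable errors, since they converge geometrically. -/
theorem summable_abs_div_sub (hu : IsPushSum G u) (hv : IsPushSum G v)
    (hG : JointlyStronglyConnected G Q) (hQ : 1 ≤ Q) {c : ℝ} (hc : 0 < c) (h0 : ∀ i, c ≤ v 0 i)
    {a b : ℝ} (ha : ∀ i, a * v 0 i ≤ u 0 i) (hb : ∀ i, u 0 i ≤ b * v 0 i) (i : Fin N) :
    Summable fun t => |u t i / v t i - (∑ j, u 0 j) / ∑ j, v 0 j| := by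
  obtain ⟨δ, hδ, hvδ⟩ := hv.exists_pos_le hG hQ hc h0
  set D : ℝ := ∑ j, v 0 j with hDdef
  have hvD : ∀ t j, v t j ≤ D := fun t j => by
    rw [hDdef, ← hv.sum_eq t]
    exact Finset.single_le_sum (fun k _ => hδ.le.trans (hvδ t k)) (Finset.mem_univ j)
  have hδD : δ ≤ D := (hvδ 0 i).trans (hvD 0 i)
  have hD : 0 < D := hδ.trans_le hδD
  have hN1 : (1 : ℝ) ≤ N := by exact_mod_cast i.pos
  have hT : 0 < N * Q := Nat.mul_pos i.pos hQ
  set q : ℝ := 1 - ((N : ℝ)⁻¹) ^ (N * Q) * (δ / (2 * D)) with hq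
  have hq1 : q < 1 := by
    rw [hq, sub_lt_self_iff]
    positivity
  have hq0 : 0 ≤ q := by
    rw [hq, sub_nonneg]
    refine mul_le_one₀ (pow_le_one₀ (by positivity) (inv_le_one_of_one_le₀ hN1)) (by positivity) ?_
    rw [div_le_one (by positivity)]
    linarith
  have hint : ∀ k : ℕ, ∃ a' b', b' - a' = (b - a) * q ^ k ∧
      (∀ j, a' * v (k * N * Q) j ≤ u (k * N * Q) j) ∧
      ∀ j, u (k * N * Q) j ≤ b' * v (k * N * Q) j := by
    intro k
    induction k with
    | zero => exact ⟨a, b, by simp, by simpa using ha, by simpa using hb⟩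
    | succ k ih =>
      obtain ⟨a', b', hab, ha', hb'⟩ := ih
      obtain ⟨a'', b'', hab', ha'', hb''⟩ :=
        hu.exists_contraction hv hG hδ hvδ hvD i ha' hb'
      rw [← Nat.succ_mul] at ha'' hb''
      exact ⟨a'', b'', by rw [hab', hab]; ring, ha'', hb''⟩
  have hbound : ∀ t, |u t i / v t i - (∑ j, u 0 j) / D| ≤ (b - a) * q ^ (t / (N * Q)) := by
    intro t
    obtain ⟨a', b', hab, ha', hb'⟩ := hint (t / (N * Q))
    have hle : t / (N * Q) * N * Q ≤ t := by
      rw [mul_assoc]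
      exact Nat.div_mul_le_self t (N * Q)
    have ha'' : ∀ j, a' * v t j ≤ u t j := fun j => sub_nonneg.1
      ((hu.sub (hv.const_mul a')).nonneg (fun j => sub_nonneg.2 (ha' j)) hle j)
    have hb'' : ∀ j, u t j ≤ b' * v t j := fun j => sub_nonneg.1
      (((hv.const_mul b').sub hu).nonneg (fun j => sub_nonneg.2 (hb' j)) hle j)
    have hvt := hδ.trans_le (hvδ t i)
    have hlow : a' ≤ (∑ j, u 0 j) / D := by
      rw [le_div_iff₀ hD, hDdef, ← hu.sum_eq t, ← hv.sum_eq t, Finset.mul_sum]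
      exact Finset.sum_le_sum fun j _ => ha'' j
    have hupp : (∑ j, u 0 j) / D ≤ b' := by
      rw [div_le_iff₀ hD, hDdef, ← hu.sum_eq t, ← hv.sum_eq t, Finset.mul_sum]
      exact Finset.sum_le_sum fun j _ => hb'' j
    rw [← hab]
    exact abs_sub_le_of_le_of_le ((le_div_iff₀ hvt).2 (ha'' i)) ((div_le_iff₀ hvt).2 (hb'' i))
      hlow hupp
  refine Summable.of_nonneg_of_le (fun t => abs_nonneg _) hbound (Summable.mul_left _ ?_)
  have : NeZero (N * Q) := ⟨hT.ne'⟩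
  -- each power of `q` occurs `N * Q` times
  have hprod : Summable fun p : ℕ × Fin (N * Q) => q ^ p.1 * 1 :=
    (summable_geometric_of_lt_one hq0 hq1).mul_of_nonneg
      (Summable.of_finite (f := fun _ : Fin (N * Q) => (1 : ℝ))) (fun k => pow_nonneg hq0 k)
      fun _ => zero_le_one
  simpa [Function.comp_def] using (Nat.divModEquiv (N * Q)).summable_iff.2 hprod

end IsPushSum

end PushSum

/-! ### Score counts and their estimates -/

namespace ScoreModel

variable {N R C a b : ℕ} (M : ScoreModel N R C a b)

theorem sum_countScore (i : Fin N) : ∑ h, M.countScore i h = M.inDeg i :=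
  (Finset.card_eq_sum_card_fiberwise fun _ _ => Finset.mem_univ _).symm

theorem countScore_le_inDeg (i : Fin N) (h : Fin R) : M.countScore i h ≤ M.inDeg i :=
  Finset.card_filter_le _ _

theorem sum_inDeg : ∑ i, M.inDeg i = M.numEdges := by
  simp only [inDeg, numEdges, scorers, Finset.card_filter, Fintype.sum_prod_type_right]

theorem one_le_inDeg (hM : ∀ i : Fin N, ∃ j : Fin N, M.scoreGraph.Adj j i) (i : Fin N) :
    1 ≤ M.inDeg i := by
  obtain ⟨j, hj⟩ := hM i
  exact Finset.card_pos.2 ⟨j, by simpa [scorers] using hj⟩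

theorem numEdges_pos (hM : ∀ i : Fin N, ∃ j : Fin N, M.scoreGraph.Adj j i) (i : Fin N) :
    0 < M.numEdges := by
  rw [← M.sum_inDeg]
  exact (M.one_le_inDeg hM i).trans
    (Finset.single_le_sum (fun _ _ => Nat.zero_le _) (Finset.mem_univ i))

theorem phi_nonneg (h : Fin R) : 0 ≤ M.phi h :=
  Finset.sum_nonneg fun _ _ => by positivity

theorem sum_phi (hM : ∀ i : Fin N, ∃ j : Fin N, M.scoreGraph.Adj j i) (i : Fin N) :
    ∑ h, M.phi h = 1 := by
  have hn : (M.numEdges : ℝ) ≠ 0 := by exact_mod_cast (M.numEdges_pos hM i).ne'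
  simp only [phi]
  rw [Finset.sum_comm]
  simp only [← Finset.sum_div]
  rw [div_eq_one_iff_eq hn]
  exact_mod_cast (Finset.sum_congr rfl fun i _ => M.sum_countScore i).trans M.sum_inDeg

/-- The gradient of the objective is the corresponding combination of the gradients of the
`g_{(h)}`. -/
theorem hasGradientWithinAt_objective
    {gradG : Fin R → ParamSpace a b → ParamSpace a b} {S : Set (ParamSpace a b)}
    {z : ParamSpace a b} (hz : ∀ h, HasGradientWithinAt (M.g h) (gradG h z) S z) :
    HasGradientWithinAt M.objective (∑ h, M.phi h • gradG h z) S z := by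
  rw [hasGradientWithinAt_iff_hasFDerivWithinAt]
  have := HasFDerivWithinAt.fun_sum (u := Finset.univ) fun h _ =>
    (hz h).hasFDerivWithinAt.const_mul (M.phi h)
  exact this.congr_fderiv (by simp [map_sum])

end ScoreModel

section Algorithm

variable {N R C a b : ℕ} (M : ScoreModel N R C a b) (G : ℕ → Digraph (Fin N))

/-- Every agent's estimate of the score frequencies converges to them with summable errors. -/
theorem summable_abs_phiEst_sub_phi (hM : ∀ i : Fin N, ∃ j : Fin N, M.scoreGraph.Adj j i)
    {Q : ℕ} (hQ : 1 ≤ Q) (hG : JointlyStronglyConnected G Q) (phi0 : Fin N → Fin R → ℝ)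
    (i : Fin N) (h : Fin R) : Summable fun t => |phiEst M G phi0 t i h - M.phi h| := by
  have hxi : IsPushSum G fun t j => xi M G t j h := fun _ _ => rfl
  have heta : IsPushSum G (eta M G) := fun _ _ => rfl
  have hsum := hxi.summable_abs_div_sub heta hG hQ (c := 1) (a := 0) (b := 1) one_pos
    (fun j => by simpa only [eta] using Nat.one_le_cast.2 (M.one_le_inDeg hM j))
    (fun j => by simp [xi]) (fun j => by simpa [xi, eta] using M.countScore_le_inDeg j h) i
  have hphi : (∑ j, xi M G 0 j h) / ∑ j, eta M G 0 j = M.phi h := by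
    simp only [xi, eta, ScoreModel.phi, Finset.sum_div, ← M.sum_inDeg, Nat.cast_sum]
  rw [hphi] at hsum
  -- the initial estimate is arbitrary, the later ones are the push-sum ratios
  exact (summable_nat_add_iff 1).1 ((summable_nat_add_iff 1).2 hsum)

theorem iterate_mem_feasible (hcompact : IsCompact M.feasible) (phi0 : Fin N → Fin R → ℝ)
    {z0 : Fin N → ParamSpace a b} (hz0 : ∀ i, z0 i ∈ M.feasible) (α : ℝ)
    (gradG : Fin R → ParamSpace a b → ParamSpace a b) (t : ℕ) (i : Fin N) :
    iterate M G phi0 z0 α gradG t i ∈ M.feasible := by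
  cases t with
  | zero => exact hz0 i
  | succ t => exact (proj_spec hcompact ⟨_, hz0 i⟩ _).1

end Algorithm

/-- A convex combination of `L`-Lipschitz maps is `L`-Lipschitz. -/
theorem lipschitzOnWith_sum_smul {ι E F : Type*} [Fintype ι] [SeminormedAddCommGroup E]
    [SeminormedAddCommGroup F] [NormedSpace ℝ F] {S : Set E} {L : ℝ≥0} {f : ι → E → F}
    {w : ι → ℝ} (hf : ∀ k, LipschitzOnWith L (f k) S) (hw : ∀ k, 0 ≤ w k) (hw1 : ∑ k, w k = 1) :
    LipschitzOnWith L (fun x => ∑ k, w k • f k x) S := by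
  refine LipschitzOnWith.of_dist_le_mul fun x hx y hy => ?_
  rw [dist_eq_norm, dist_eq_norm, ← Finset.sum_sub_distrib]
  calc ‖∑ k, (w k • f k x - w k • f k y)‖ ≤ ∑ k, w k * (L * ‖x - y‖) := by
        refine norm_sum_le_of_le _ fun k _ => ?_
        rw [← smul_sub, norm_smul, Real.norm_of_nonneg (hw k)]
        exact mul_le_mul_of_nonneg_left ((hf k).norm_sub_le hx hy) (hw k)
    _ = L * ‖x - y‖ := by rw [← Finset.sum_mul, hw1, one_mul]

end InteractionLearning

theorem mainTheorem4 {N R C a b : ℕ}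
    (M : InteractionLearning.ScoreModel N R C a b)
    (hM : ∀ i : Fin N, ∃ j : Fin N, M.scoreGraph.Adj j i)
    (Gcmm : ℕ → Digraph (Fin N))
    (hconn : ∃ Q : ℕ, 1 ≤ Q ∧ InteractionLearning.JointlyStronglyConnected Gcmm Q)
    (hcompact : IsCompact M.feasible)
    (hconvex : Convex ℝ M.feasible)
    (gradG : Fin R → InteractionLearning.ParamSpace a b → InteractionLearning.ParamSpace a b)
    (hdiff : ∀ h : Fin R, ∀ z ∈ M.feasible, HasGradientWithinAt (M.g h) (gradG h z) M.feasible z)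
    (hbdd : ∃ B : ℝ, ∀ h : Fin R, ∀ z ∈ M.feasible, ‖gradG h z‖ ≤ B)
    (L : ℝ≥0) (hL : 0 < L)
    (hlip : ∀ h : Fin R, LipschitzOnWith L (gradG h) M.feasible)
    (α : ℝ) (hα : 0 < α) (hαL : α < 2 / (L : ℝ))
    (phi0 : Fin N → Fin R → ℝ)
    (z0 : Fin N → InteractionLearning.ParamSpace a b)
    (hz0 : ∀ i : Fin N, z0 i ∈ M.feasible)
    (i : Fin N) (zlim : InteractionLearning.ParamSpace a b)
    (hlim : MapClusterPt zlim atTop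
      (fun t : ℕ => InteractionLearning.iterate M Gcmm phi0 z0 α gradG t i)) :
    InteractionLearning.IsStationaryPoint M.objective M.feasible zlim ∧
      zlim = InteractionLearning.proj M.feasible
        (zlim - α • ∑ h, M.phi h • gradG h zlim) := by
  obtain ⟨Q, hQ, hG⟩ := hconn
  obtain ⟨B, hB⟩ := hbdd
  set z : ℕ → InteractionLearning.ParamSpace a b := fun t =>
    InteractionLearning.iterate M Gcmm phi0 z0 α gradG t i
  set F : InteractionLearning.ParamSpace a b → InteractionLearning.ParamSpace a b := fun x =>
    ∑ h, M.phi h • gradG h x with hF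
  -- the gradient error caused by the error of the estimated score frequencies
  set e : ℕ → InteractionLearning.ParamSpace a b := fun t =>
    ∑ h, (InteractionLearning.phiEst M Gcmm phi0 t i h - M.phi h) • gradG h (z t) with he
  have hz : ∀ t, z t ∈ M.feasible := fun t =>
    InteractionLearning.iterate_mem_feasible M Gcmm hcompact phi0 hz0 α gradG t i
  have hgrad : ∀ x ∈ M.feasible, HasGradientWithinAt M.objective (F x) M.feasible x :=
    fun x hx => M.hasGradientWithinAt_objective fun h => hdiff h x hx
  have hFlip : LipschitzOnWith L F M.feasible :=
    InteractionLearning.lipschitzOnWith_sum_smul hlip M.phi_nonneg (M.sum_phi hM i)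
  have hstep : ∀ t, z (t + 1) =
      InteractionLearning.proj M.feasible (z t - α • (F (z t) + e t)) := by
    intro t
    have hsplit : F (z t) + e t =
        ∑ h, InteractionLearning.phiEst M Gcmm phi0 t i h • gradG h (z t) := by
      simp only [hF, he, ← Finset.sum_add_distrib, ← add_smul, add_sub_cancel]
    rw [hsplit]
    rfl
  have hsum : Summable fun t => ‖e t‖ := by
    refine Summable.of_nonneg_of_le (fun t => norm_nonneg _) (fun t => ?_)
      (summable_sum fun h (_ : h ∈ Finset.univ) =>
        (InteractionLearning.summable_abs_phiEst_sub_phi M Gcmm hM hQ hG phi0 i h).mul_right B)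
    refine norm_sum_le_of_le _ fun h _ => ?_
    rw [norm_smul, Real.norm_eq_abs]
    exact mul_le_mul_of_nonneg_left (hB h _ (hz t)) (abs_nonneg _)
  obtain ⟨hmem, hvar⟩ := InteractionLearning.inner_gradient_nonneg_of_mapClusterPt hcompact
    hconvex hL hgrad hFlip hα hαL hz hstep hsum hlim
  refine ⟨⟨hmem, F zlim, hgrad _ hmem, hvar⟩,
    InteractionLearning.eq_proj_of_inner_le_zero hcompact hconvex hmem fun y hy => ?_⟩
  rw [sub_sub_cancel_left, inner_neg_left, real_inner_smul_left, neg_nonpos]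
  exact mul_nonneg hα.le (hvar y hy)
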